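/- Let $k,\lambda,\beta_1,\beta_2>0$ and $0\le p\le 1$. On a probability space let $Z(t)=\sum_{n=1}^{N(t)}J_n$, $t\ge 0$, be a compound Poisson process, where $N$ is a Poisson process of intensity $\lambda$ and the jumps $J_n$ are i.i.d., independent of $N$, with the double-exponential density $p\,\beta_1e^{-\beta_1x}\mathbf 1_{x\ge0}+(1-p)\,\beta_2e^{\beta_2x}\mathbf 1_{x<0}$. Let $X$ be the solution of the Ornstein--Uhlenbeck equation $dX(t)=-kX(t)\,dt+dZ(t)$, $X(0)=X_0$ a.s., where $X_0$ is independent of $Z$. Then for all $s,t\ge0$ and $v\in\mathbb R$, almost surely, $$\mathbb E\big[e^{ivX(t+s)}\,\big|\,X(s)\big]=e^{ivX(s)e^{-kt}}\left(\frac{\beta_1-ive^{-kt}}{\beta_1-iv}\right)^{p\lambda/k}\left(\frac{\beta_2+ive^{-kt}}{\beta_2+iv}\right)^{(1-p)\lambda/k},$$ with principal values of the powers. Moreover, if $0<p<1$, the stationary law of $X$ is the bilateral gamma law with parameters $\alpha_1=p\lambda/k$, $\beta_1$, $\alpha_2=(1-p)\lambda/k$, $\beta_2$, that is, the law of $G_1-G_2$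 with $G_1,G_2$ independent and $G_i$ gamma distributed with shape $\alpha_i$ and rate $\beta_i$: the law of $X(t)$ equals that of $X_0$ for all $t\ge 0$ if and only if $X_0$ has this bilateral gamma law, and for every $X_0$ the law of $X(t)$ converges weakly to it as $t\to\infty$. -/

import Mathlib

open MeasureTheory ProbabilityTheory Filter Topology
open scoped NNReal ENNReal BoundedContinuousFunction

namespace BilateralGammaOU

/-- The double exponential law: the law on `ℝ` with density
`p β₁ exp (-β₁ x)` for `x ≥ 0` and `(1 - p) β₂ exp (β₂ x)` for `x < 0`. -/
noncomputable def doubleExponential (p β₁ β₂ : ℝ) : Measure ℝ :=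
  volume.withDensity fun x => ENNReal.ofReal
    (if 0 ≤ x then p * β₁ * Real.exp (-β₁ * x) else (1 - p) * β₂ * Real.exp (β₂ * x))

/-- The bilateral gamma law: the law of `G₁ - G₂` with `G₁`, `G₂` independent,
`Gᵢ` gamma distributed with shape `αᵢ` and rate `βᵢ`. -/
noncomputable def bilateralGamma (α₁ β₁ α₂ β₂ : ℝ) : Measure ℝ :=
  ((gammaMeasure α₁ β₁).prod (gammaMeasure α₂ β₂)).map fun x => x.1 - x.2

/-- `N` is a Poisson process of intensity `lam`: it starts at `0`, its increments are independent
and the increment over `[s, t]` is Poisson with parameter `lam * (t - s)`, and almost all its paths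
are nondecreasing and right-continuous. Increments are taken in `ℝ`. -/
structure IsPoissonProcess {Ω : Type*} [MeasurableSpace Ω] (lam : ℝ≥0) (N : ℝ≥0 → Ω → ℕ)
    (μ : Measure Ω) : Prop where
  measurable : ∀ t, Measurable (N t)
  zero : ∀ᵐ ω ∂μ, N 0 ω = 0
  indep : HasIndepIncrements (fun t ω => (N t ω : ℝ)) μ
  law : ∀ s t, s ≤ t → HasLaw (fun ω => (N t ω : ℝ) - (N s ω : ℝ))
    ((poissonMeasure (lam * (t - s))).map (Nat.cast : ℕ → ℝ)) μ
  mono : ∀ᵐ ω ∂μ, Monotone fun t => N t ω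
  rightCont : ∀ᵐ ω ∂μ, ∀ t, ContinuousWithinAt (fun u => N u ω) (Set.Ici t) t

/-- `Z` is a compound Poisson process with intensity `lam` and jump law `ν`: almost surely
`Z t = ∑_{n < N t} J n` for all `t`, where `N` is a Poisson process of intensity `lam` and the `J n`
are i.i.d. with law `ν`, independent of the whole process `N`. -/
structure IsCompoundPoisson {Ω : Type*} [MeasurableSpace Ω] (lam : ℝ≥0) (ν : Measure ℝ)
    (Z : ℝ≥0 → Ω → ℝ) (μ : Measure Ω) : Prop where
  measurable : ∀ t, Measurable (Z t)
  exists_repr : ∃ (N : ℝ≥0 → Ω → ℕ) (J : ℕ → Ω → ℝ),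
    IsPoissonProcess lam N μ ∧
    (∀ n, Measurable (J n)) ∧ (∀ n, HasLaw (J n) ν μ) ∧ iIndepFun J μ ∧
    IndepFun (fun ω n => J n ω) (fun ω t => N t ω) μ ∧
    ∀ᵐ ω ∂μ, ∀ t, Z t ω = ∑ n ∈ Finset.range (N t ω), J n ω

/-- `X` is the solution of `dX t = -k X t dt + dZ t`, `X 0 = X₀` a.s., driven by a process `Z`
with `Z 0 = 0` a.s.: almost all paths of `X` are locally integrable and satisfy
`X t = X₀ - k ∫₀ᵗ X u du + Z t` for all `t ≥ 0`. The initial value is independent of `Z`. -/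
structure IsOUSolution {Ω : Type*} [MeasurableSpace Ω] (k : ℝ) (X₀ : Ω → ℝ)
    (Z X : ℝ≥0 → Ω → ℝ) (μ : Measure Ω) : Prop where
  measurable_init : Measurable X₀
  indep_init : IndepFun X₀ (fun ω t => Z t ω) μ
  measurable : ∀ t, Measurable (X t)
  integrable : ∀ᵐ ω ∂μ, ∀ t : ℝ≥0,
    IntervalIntegrable (fun u : ℝ => X u.toNNReal ω) volume 0 t
  eq : ∀ᵐ ω ∂μ, ∀ t : ℝ≥0,
    X t ω = X₀ ω - k * (∫ u in (0 : ℝ)..t, X u.toNNReal ω) + Z t ω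

end BilateralGammaOU

namespace BilateralGammaOU

/-! The explicit solution is `X (s + t) = exp (-k t) X s + ∫ exp (-k (s + t - u)) dZ u` over `(s, s
+ t]`. The integral is independent of `X s`, and the logarithm of its characteristic function at `v`
is `∫₀ᵗ lam (φ (v exp (-k r)) - 1) dr`, with `φ` the characteristic function of a jump. For double
exponential jumps `φ w - 1 = p i w / (β₁ - i w) - (1 - p) i w / (β₂ + i w)`, so this integrand has a
primitive `G v` made of two logarithms (`hasDerivAt_cumulantPrimitive`), and exponentiating its
increment gives the two powers.

No stochastic integral is needed: `tendsto_stieltjesSum` obtains the explicit solution pathwise as a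
limit of finite sums of increments of `Z`. Their joint characteristic function is a product of
exponentials (`IsCompoundPoisson.integral_exp_increments`), whose exponents form Riemann sums. The
limit, `IsOUSolution.integral_exp`, factorises; this yields the independence, hence the conditional
formula.

The bilateral gamma characteristic function is `exp (L - G v 0)`, where `L` is the limit of `G v t`
as `t → ∞`. Since `v exp (-k t) → 0`, the influence of `X₀` vanishes and Lévy's theorem gives weak
convergence. Uniqueness of the invariant law follows from convergence, and invariance is a
cancellation of exponents. -/

/-! ### Principal powers of quotients in the right half-plane. -/

/-- Both arguments lie in `(-π/2, π/2)`, so their difference stays in `(-π, π)` and no multiple of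
`2πi` appears. -/
lemma log_div_of_re_pos {a b : ℂ} (ha : 0 < a.re) (hb : 0 < b.re) :
    Complex.log (a / b) = Complex.log a - Complex.log b := by
  have ha0 : a ≠ 0 := by rintro rfl; simp at ha
  have hb0 : b ≠ 0 := by rintro rfl; simp at hb
  have h1 := abs_lt.1 (Complex.abs_arg_lt_pi_div_two_iff.2 (Or.inl ha))
  have h2 := abs_lt.1 (Complex.abs_arg_lt_pi_div_two_iff.2 (Or.inl hb))
  rw [← Complex.log_exp (x := Complex.log a - Complex.log b), Complex.exp_sub,
    Complex.exp_log ha0, Complex.exp_log hb0]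
  · rw [Complex.sub_im, Complex.log_im, Complex.log_im]; linarith
  · rw [Complex.sub_im, Complex.log_im, Complex.log_im]; linarith

lemma cpow_div_of_re_pos {a b : ℂ} (ha : 0 < a.re) (hb : 0 < b.re) (c : ℂ) :
    (a / b) ^ c = Complex.exp (c * (Complex.log a - Complex.log b)) := by
  have ha0 : a ≠ 0 := by rintro rfl; simp at ha
  have hb0 : b ≠ 0 := by rintro rfl; simp at hb
  rw [Complex.cpow_def_of_ne_zero (div_ne_zero ha0 hb0), log_div_of_re_pos ha hb, mul_comm]

lemma re_sub_I_mul {β : ℝ} (hβ : 0 < β) (v : ℝ) : 0 < ((β : ℂ) - Complex.I * v).re := by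
  simpa using hβ

lemma re_add_I_mul {β : ℝ} (hβ : 0 < β) (v : ℝ) : 0 < ((β : ℂ) + Complex.I * v).re := by
  simpa using hβ

/-! ### Characteristic functions of the gamma, bilateral gamma and double exponential laws. -/

lemma mgf_gammaMeasure {a r t : ℝ} (ha : 0 < a) (hr : 0 < r) (ht : t < r) :
    mgf id (gammaMeasure a r) t = (r / (r - t)) ^ a := by
  have hG := (Real.Gamma_pos_of_pos ha).ne'
  rw [mgf, gammaMeasure, integral_withDensity_eq_integral_toReal_smul
    (by unfold gammaPDF; fun_prop) (ae_of_all _ fun x => by simp [gammaPDF])]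
  have h : ∀ x, (gammaPDF a r x).toReal • Real.exp (t * id x) =
      (Set.Ici (0 : ℝ)).indicator (fun x => r ^ a / Real.Gamma a *
        (x ^ (a - 1) * Real.exp (-((r - t) * x)))) x := by
    intro x
    rw [gammaPDF, ENNReal.toReal_ofReal (gammaPDFReal_nonneg ha hr x), gammaPDFReal]
    by_cases hx : 0 ≤ x
    · rw [if_pos hx, Set.indicator_of_mem (Set.mem_Ici.2 hx), smul_eq_mul, id, mul_assoc, mul_assoc,
        ← Real.exp_add]
      ring_nf
    · rw [if_neg hx, Set.indicator_of_notMem (by simpa using hx), zero_smul]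
  simp_rw [h]
  rw [integral_indicator measurableSet_Ici, integral_Ici_eq_integral_Ioi, integral_const_mul,
    Real.integral_rpow_mul_exp_neg_mul_Ioi ha (sub_pos.2 ht), Real.div_rpow hr.le
      (sub_pos.2 ht).le, Real.div_rpow zero_le_one (sub_pos.2 ht).le, Real.one_rpow]
  field_simp

/-- A non-integrable function has Bochner integral `0`, whereas the closed form of the moment
generating function is positive. -/
lemma Iio_subset_interior_integrableExpSet_gammaMeasure {a r : ℝ} (ha : 0 < a) (hr : 0 < r) :
    Set.Iio r ⊆ interior (integrableExpSet id (gammaMeasure a r)) := by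
  refine interior_maximal (fun t ht => ?_) isOpen_Iio
  by_contra h
  have := mgf_gammaMeasure ha hr ht
  rw [mgf, integral_undef h] at this
  exact absurd this (Real.rpow_pos_of_pos (div_pos hr (sub_pos.2 ht)) a).ne

/-- Identity theorem: both sides are analytic on the half-plane `re z < r` and agree at real points
accumulating at `0`. -/
lemma complexMGF_gammaMeasure {a r : ℝ} (ha : 0 < a) (hr : 0 < r) {z : ℂ} (hz : z.re < r) :
    complexMGF id (gammaMeasure a r) z =
      Complex.exp (a * (Complex.log r - Complex.log (r - z))) := by
  let U : Set ℂ := {z | z.re < r}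
  have hU : IsOpen U := isOpen_lt Complex.continuous_re continuous_const
  have hf : AnalyticOnNhd ℂ (complexMGF id (gammaMeasure a r)) U := fun z hz =>
    analyticAt_complexMGF (Iio_subset_interior_integrableExpSet_gammaMeasure ha hr hz)
  have hg : AnalyticOnNhd ℂ
      (fun z => Complex.exp (a * (Complex.log r - Complex.log (r - z)))) U := by
    refine DifferentiableOn.analyticOnNhd (fun z hz => ?_) hU
    have hs : (r : ℂ) - z ∈ Complex.slitPlane :=
      Or.inl (by simpa using show z.re < r from hz)
    refine (((((differentiableAt_const _).sub differentiableAt_id).clog hs).const_sub _).const_mul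
      _).cexp.differentiableWithinAt
  refine hf.eqOn_of_preconnected_of_frequently_eq hg
    (convex_halfSpace_re_lt r).isPreconnected (z₀ := 0) (by simpa [U] using hr) ?_ hz
  -- Negative reals tending to `0` lie in the half-plane whatever the value of `r > 0`.
  have ht : Tendsto (fun n : ℕ => (((-1 / ((n : ℝ) + 1) : ℝ)) : ℂ)) atTop (𝓝[≠] 0) := by
    refine tendsto_nhdsWithin_iff.2 ⟨?_, Eventually.of_forall fun n => ?_⟩
    · rw [← Complex.ofReal_zero]
      refine (Complex.continuous_ofReal.tendsto 0).comp ?_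
      simpa [neg_div] using (tendsto_one_div_add_atTop_nhds_zero_nat (𝕜 := ℝ)).neg
    · rw [Set.mem_compl_singleton_iff, Complex.ofReal_ne_zero]
      exact div_ne_zero (by norm_num) (by positivity)
  refine ht.frequently (Frequently.of_forall fun n => ?_)
  have hn : -1 / ((n : ℝ) + 1) < r :=
    (div_neg_of_neg_of_pos (by norm_num) (by positivity)).trans hr
  rw [complexMGF_ofReal, mgf_gammaMeasure ha hr hn,
    Complex.ofReal_cpow (div_pos hr (sub_pos.2 hn)).le, Complex.ofReal_div,
    cpow_div_of_re_pos (by simpa using hr)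
      (by rw [Complex.ofReal_re]; exact sub_pos.2 hn), Complex.ofReal_sub]

lemma charFun_gammaMeasure {a r : ℝ} (ha : 0 < a) (hr : 0 < r) (v : ℝ) :
    charFun (gammaMeasure a r) v =
      Complex.exp (a * (Complex.log r - Complex.log (r - Complex.I * v))) := by
  rw [← complexMGF_id_mul_I, complexMGF_gammaMeasure ha hr (by simpa using hr), mul_comm _ Complex.I]

lemma isProbabilityMeasure_bilateralGamma {α₁ β₁ α₂ β₂ : ℝ} (hα₁ : 0 < α₁) (hβ₁ : 0 < β₁)
    (hα₂ : 0 < α₂) (hβ₂ : 0 < β₂) : IsProbabilityMeasure (bilateralGamma α₁ β₁ α₂ β₂) := by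
  have := isProbabilityMeasure_gammaMeasure hα₁ hβ₁
  have := isProbabilityMeasure_gammaMeasure hα₂ hβ₂
  exact Measure.isProbabilityMeasure_map (by fun_prop)

lemma charFun_bilateralGamma {α₁ β₁ α₂ β₂ : ℝ} (hα₁ : 0 < α₁) (hβ₁ : 0 < β₁)
    (hα₂ : 0 < α₂) (hβ₂ : 0 < β₂) (v : ℝ) :
    charFun (bilateralGamma α₁ β₁ α₂ β₂) v =
      Complex.exp (α₁ * (Complex.log β₁ - Complex.log (β₁ - Complex.I * v)) +
        α₂ * (Complex.log β₂ - Complex.log (β₂ + Complex.I * v))) := by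
  have := isProbabilityMeasure_gammaMeasure hα₁ hβ₁
  have := isProbabilityMeasure_gammaMeasure hα₂ hβ₂
  rw [bilateralGamma, charFun_apply_real, integral_map (by fun_prop) (by fun_prop)]
  have h : ∀ x : ℝ × ℝ, Complex.exp (v * ((x.1 - x.2 : ℝ) : ℂ) * Complex.I) =
      Complex.exp (v * x.1 * Complex.I) * Complex.exp (((-v : ℝ) : ℂ) * x.2 * Complex.I) := by
    intro x
    rw [← Complex.exp_add]
    push_cast
    ring_nf
  simp_rw [h]
  rw [integral_prod_mul (fun x : ℝ => Complex.exp (v * x * Complex.I))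
    (fun x : ℝ => Complex.exp (((-v : ℝ) : ℂ) * x * Complex.I)), ← charFun_apply_real,
    ← charFun_apply_real, charFun_gammaMeasure hα₁ hβ₁, charFun_gammaMeasure hα₂ hβ₂,
    ← Complex.exp_add]
  push_cast
  ring_nf

lemma charFun_doubleExponential {p β₁ β₂ : ℝ} (hβ₁ : 0 < β₁) (hβ₂ : 0 < β₂) (hp₀ : 0 ≤ p)
    (hp₁ : p ≤ 1) (v : ℝ) :
    charFun (doubleExponential p β₁ β₂) v =
      p * β₁ / (β₁ - Complex.I * v) + (1 - p) * β₂ / (β₂ + Complex.I * v) := by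
  have hd : Measurable fun x : ℝ =>
      (if 0 ≤ x then p * β₁ * Real.exp (-β₁ * x) else (1 - p) * β₂ * Real.exp (β₂ * x)) :=
    Measurable.ite measurableSet_Ici (by fun_prop) (by fun_prop)
  have hp : 0 ≤ 1 - p := sub_nonneg.2 hp₁
  rw [charFun_apply_real, doubleExponential,
    integral_withDensity_eq_integral_toReal_smul hd.ennreal_ofReal (ae_of_all _ fun x => by simp)]
  have hc₁ : ((-(β₁ - Complex.I * v) : ℂ)).re < 0 := by simpa using hβ₁
  have hc₂ := re_add_I_mul hβ₂ v
  have h : ∀ x : ℝ, (ENNReal.ofReal (if 0 ≤ x then p * β₁ * Real.exp (-β₁ * x)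
      else (1 - p) * β₂ * Real.exp (β₂ * x))).toReal • Complex.exp (v * x * Complex.I) =
      (Set.Ici (0 : ℝ)).indicator (fun x : ℝ => (p * β₁ : ℂ) *
        Complex.exp (-(β₁ - Complex.I * v) * x)) x +
      (Set.Iio (0 : ℝ)).indicator (fun x : ℝ => ((1 - p) * β₂ : ℂ) *
        Complex.exp ((β₂ + Complex.I * v) * x)) x := by
    intro x
    by_cases hx : 0 ≤ x
    · rw [if_pos hx, Set.indicator_of_mem (Set.mem_Ici.2 hx),
        Set.indicator_of_notMem (by simpa using hx), add_zero,
        ENNReal.toReal_ofReal (by positivity), Complex.real_smul, Complex.ofReal_mul,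
        Complex.ofReal_mul, Complex.ofReal_exp, mul_assoc, ← Complex.exp_add]
      push_cast
      ring_nf
    · rw [if_neg hx, Set.indicator_of_notMem (by simpa using hx),
        Set.indicator_of_mem (by simpa using hx), zero_add,
        ENNReal.toReal_ofReal (by positivity), Complex.real_smul, Complex.ofReal_mul,
        Complex.ofReal_mul, Complex.ofReal_exp, mul_assoc, ← Complex.exp_add]
      push_cast
      ring_nf
  simp_rw [h]
  rw [integral_add, integral_indicator measurableSet_Ici, integral_indicator measurableSet_Iio,
    integral_Ici_eq_integral_Ioi, ← integral_Iic_eq_integral_Iio, integral_const_mul,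
    integral_const_mul, integral_exp_mul_complex_Ioi hc₁, integral_exp_mul_complex_Iic hc₂]
  · simp only [Complex.ofReal_zero, mul_zero, Complex.exp_zero, neg_div_neg_eq, mul_one_div]
  · exact (integrable_indicator_iff measurableSet_Ici).2
      (((integrableOn_Ici_iff_integrableOn_Ioi).2
        (integrableOn_exp_mul_complex_Ioi hc₁ 0)).const_mul _)
  · exact (integrable_indicator_iff measurableSet_Iio).2
      (((integrableOn_exp_mul_complex_Iic hc₂ 0).mono_set Set.Iio_subset_Iic_self).const_mul _)

/-! ### Riemann sums and the primitive of the cumulant. -/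

/-- Left Riemann sums on uniform partitions converge to the increment of a primitive. -/
lemma tendsto_leftRiemannSum {G f : ℝ → ℂ} (hG : ∀ r, HasDerivAt G (f r) r) (hf : Continuous f)
    {t : ℝ} (ht : 0 ≤ t) :
    Tendsto (fun n : ℕ => ∑ j ∈ Finset.range n, ((t / n : ℝ) : ℂ) * f (t * j / n)) atTop
      (𝓝 (G t - G 0)) := by
  rw [Metric.tendsto_atTop]
  intro ε hε
  have hu : UniformContinuousOn f (Set.Icc 0 t) :=
    isCompact_Icc.uniformContinuousOn_of_continuous hf.continuousOn
  -- Dividing by `t + 1` rather than `t` covers `t = 0` and makes the final bound `ε t / (t + 1)`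
  -- strictly less than `ε`.
  obtain ⟨δ, hδ, hfδ⟩ := Metric.uniformContinuousOn_iff.1 hu (ε / (t + 1)) (by positivity)
  obtain ⟨n₀, hn₀⟩ := exists_nat_gt (t / δ)
  refine ⟨n₀ + 1, fun n hn => ?_⟩
  have hn' : (n₀ : ℝ) + 1 ≤ n := by exact_mod_cast hn
  have hnpos : (0 : ℝ) < n := lt_of_lt_of_le (by positivity) hn'
  have hh : t / n < δ := by
    rw [div_lt_iff₀ hnpos]
    rw [div_lt_iff₀ hδ] at hn₀
    nlinarith
  have hstep : ∀ j ∈ Finset.range n,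
      ‖((t / n : ℝ) : ℂ) * f (t * j / n) - (G (t * (j + 1 : ℕ) / n) - G (t * j / n))‖ ≤
        ε / (t + 1) * (t / n) := by
    intro j hj
    have hj' : (j : ℝ) + 1 ≤ n := by exact_mod_cast Finset.mem_range.1 hj
    set a := t * j / n with ha
    set b := t * (j + 1 : ℕ) / n with hb
    have hab : b - a = t / n := by rw [ha, hb]; push_cast; ring
    have ha0 : 0 ≤ a := by positivity
    have hbt : b ≤ t := by
      rw [hb, div_le_iff₀ hnpos]; push_cast; nlinarith
    have hab' : a ≤ b := by linarith [show 0 ≤ t / n by positivity]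
    -- The mean value inequality applied to `G x - x f a` bounds the error of one cell.
    have hd : ∀ x ∈ Set.Icc a b, HasDerivWithinAt (fun x => G x - ((x : ℝ) : ℂ) * f a)
        (f x - 1 * f a) (Set.Icc a b) x := fun x _ =>
      ((hG x).sub (Complex.ofRealCLM.hasDerivAt.mul_const (f a))).hasDerivWithinAt
    have hbd : ∀ x ∈ Set.Icc a b, ‖f x - 1 * f a‖ ≤ ε / (t + 1) := fun x hx => by
      rw [one_mul, ← dist_eq_norm]
      refine (hfδ x ⟨ha0.trans hx.1, hx.2.trans hbt⟩ a ⟨ha0, hab'.trans hbt⟩ ?_).le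
      rw [Real.dist_eq, abs_of_nonneg (by linarith [hx.1])]
      linarith [hx.2]
    have := (convex_Icc a b).norm_image_sub_le_of_norm_hasDerivWithin_le hd hbd
      (Set.left_mem_Icc.2 hab') (Set.right_mem_Icc.2 hab')
    rw [hab, Real.norm_of_nonneg (by positivity)] at this
    have e : ((t / n : ℝ) : ℂ) * f a - (G b - G a) = -(G b - b * f a - (G a - a * f a)) := by
      rw [← hab]
      push_cast
      ring
    rw [e, norm_neg]
    exact this
  have htel : ∑ j ∈ Finset.range n, (G (t * (j + 1 : ℕ) / n) - G (t * j / n)) = G t - G 0 := by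
    rw [Finset.sum_range_sub (fun j : ℕ => G (t * j / n))]
    simp [mul_div_assoc, div_self hnpos.ne']
  rw [dist_eq_norm, ← htel, ← Finset.sum_sub_distrib]
  calc _ ≤ ∑ j ∈ Finset.range n, ε / (t + 1) * (t / n) := norm_sum_le_of_le _ hstep
    _ = ε * (t / (t + 1)) := by
      rw [Finset.sum_const, Finset.card_range, nsmul_eq_mul]; field_simp
    _ < ε * 1 := by
      refine mul_lt_mul_of_pos_left ?_ hε
      rw [div_lt_one (by positivity)]; linarith
    _ = ε := mul_one ε

/-- A primitive of `r ↦ lam (φ (v exp (-k r)) - 1)`, where `φ` is the characteristic function of the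
double exponential law. -/
noncomputable def cumulantPrimitive (k lam p β₁ β₂ v r : ℝ) : ℂ :=
  (p * lam / k : ℝ) * Complex.log (β₁ - Complex.I * (v * Real.exp (-k * r) : ℝ)) +
    ((1 - p) * lam / k : ℝ) * Complex.log (β₂ + Complex.I * (v * Real.exp (-k * r) : ℝ))

/-- With `w = v exp (-k r)` one has `w' = -k w`; this factor `k` cancels the `1 / k` of the
coefficients, and partial fractions of `φ w - 1` do the rest. -/
lemma hasDerivAt_cumulantPrimitive {k lam p β₁ β₂ : ℝ} (hk : k ≠ 0) (hβ₁ : 0 < β₁) (hβ₂ : 0 < β₂)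
    (hp₀ : 0 ≤ p) (hp₁ : p ≤ 1) (v r : ℝ) :
    HasDerivAt (cumulantPrimitive k lam p β₁ β₂ v)
      (lam * (charFun (doubleExponential p β₁ β₂) (v * Real.exp (-k * r)) - 1)) r := by
  have hw : HasDerivAt (fun r => v * Real.exp (-k * r)) (v * (Real.exp (-k * r) * (-k * 1))) r :=
    (((hasDerivAt_id r).const_mul (-k)).exp).const_mul v
  have hw' := hw.ofReal_comp.const_mul Complex.I
  set w := v * Real.exp (-k * r) with hwdef
  have h₁ := re_sub_I_mul hβ₁ w
  have h₂ := re_add_I_mul hβ₂ w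
  have h := (((hw'.const_sub (β₁ : ℂ)).clog_real (Or.inl h₁)).const_mul ((p * lam / k : ℝ) : ℂ)).add
    (((hw'.const_add (β₂ : ℂ)).clog_real (Or.inl h₂)).const_mul (((1 - p) * lam / k : ℝ) : ℂ))
  refine h.congr_deriv ?_
  rw [charFun_doubleExponential hβ₁ hβ₂ hp₀ hp₁]
  have hv : v * (Real.exp (-k * r) * (-k * 1)) = -k * w := by rw [hwdef]; ring
  rw [hv, ← hwdef]
  have h₁' : (β₁ : ℂ) - Complex.I * w ≠ 0 := by intro h; rw [h] at h₁; simp at h₁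
  have h₂' : (β₂ : ℂ) + Complex.I * w ≠ 0 := by intro h; rw [h] at h₂; simp at h₂
  have hk' : (k : ℂ) ≠ 0 := by exact_mod_cast hk
  push_cast
  field_simp
  ring

lemma continuous_charFun_mul_exp_sub_one {k lam : ℝ} {ν : Measure ℝ} [IsFiniteMeasure ν] (v : ℝ) :
    Continuous fun r : ℝ => (lam : ℂ) * (charFun ν (v * Real.exp (-k * r)) - 1) := by
  have := continuous_charFun (μ := ν)
  fun_prop

/-! ### Paths of the Ornstein-Uhlenbeck equation. -/

/-- On an interval on which the driving path is constant, a path of the Ornstein-Uhlenbeck equation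
decays exponentially. -/
lemma eq_exp_mul_of_const {k x₀ a b : ℝ} {z y : ℝ → ℝ} (ha : 0 ≤ a) (hab : a ≤ b)
    (hint : IntervalIntegrable y volume 0 b)
    (heq : ∀ u ∈ Set.Icc a b, y u = x₀ - k * (∫ r in (0 : ℝ)..u, y r) + z u)
    (hz : ∀ u ∈ Set.Icc a b, z u = z a) :
    y b = Real.exp (-k * (b - a)) * y a := by
  have hb : 0 ≤ b := ha.trans hab
  have hI : ContinuousOn (fun u => ∫ r in (0 : ℝ)..u, y r) (Set.Icc a b) := by
    have := intervalIntegral.continuousOn_primitive_interval' hint Set.left_mem_uIcc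
    rw [Set.uIcc_of_le hb] at this
    exact this.mono (Set.Icc_subset_Icc_left ha)
  -- Only integrability of `y` is assumed; the equation itself makes `y` continuous here, and then
  -- `exp (k u) y u` has right derivative zero.
  have hyc : ContinuousOn y (Set.Icc a b) := by
    have : ContinuousOn (fun u => x₀ - k * (∫ r in (0 : ℝ)..u, y r) + z a) (Set.Icc a b) := by
      fun_prop
    exact this.congr fun u hu => by rw [heq u hu, hz u hu]
  have hconst := constant_of_has_deriv_right_zero (f := fun u => Real.exp (k * u) * y u)
    (a := a) (b := b) (by fun_prop) (fun u hu => ?_) b (Set.right_mem_Icc.2 hab)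
  · rw [mul_sub, Real.exp_sub, div_mul_eq_mul_div, eq_div_iff (Real.exp_pos _).ne']
    have h : Real.exp (-k * b) * (Real.exp (k * b) * y b) =
        Real.exp (-k * b) * (Real.exp (k * a) * y a) := congrArg _ hconst
    rw [← mul_assoc, ← Real.exp_add, neg_mul, neg_add_cancel, Real.exp_zero, one_mul] at h
    rw [h, mul_assoc, neg_mul, neg_mul]
    have : Real.exp (k * a) * Real.exp (-(k * a)) = 1 := by
      rw [← Real.exp_add, add_neg_cancel, Real.exp_zero]
    linear_combination (Real.exp (-(k * b)) * y a) * this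
  · have huI : Set.Icc a b ∈ 𝓝[≥] u := Icc_mem_nhdsGE_of_mem hu
    have huI' : Set.Icc a b ∈ 𝓝[>] u := nhdsWithin_mono u Set.Ioi_subset_Ici_self huI
    have hmem : u ∈ Set.Icc a b := Set.Ico_subset_Icc_self hu
    have hcw : ContinuousWithinAt y (Set.Ioi u) u := (hyc u hmem).mono_of_mem_nhdsWithin huI'
    have hd := intervalIntegral.integral_hasDerivWithinAt_right (s := Set.Ici u) (t := Set.Ioi u)
      (hint.mono_set (by
        rw [Set.uIcc_of_le hb, Set.uIcc_of_le (ha.trans hmem.1)]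
        exact Set.Icc_subset_Icc_right hmem.2))
      ⟨Set.Icc a b, huI', hyc.aestronglyMeasurable measurableSet_Icc⟩ hcw
    have hy : HasDerivWithinAt y (-(k * y u)) (Set.Ici u) u := by
      have h1 : HasDerivWithinAt (fun w => x₀ - k * (∫ r in (0 : ℝ)..w, y r) + z a)
          (-(k * y u)) (Set.Ici u) u := ((hd.const_mul k).const_sub x₀).add_const _
      refine h1.congr_of_eventuallyEq ?_ (by rw [heq u hmem, hz u hmem])
      filter_upwards [huI] with w hw
      rw [heq w hw, hz w hw]
    have he : HasDerivWithinAt (fun w => Real.exp (k * w)) (Real.exp (k * u) * (k * 1))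
        (Set.Ici u) u := (((hasDerivAt_id u).const_mul k).exp).hasDerivWithinAt
    exact (he.mul hy).congr_deriv (by ring)

/-- A path of the Ornstein-Uhlenbeck equation driven by a step path with jumps `J` is the limit of
the Riemann-Stieltjes sums of its explicit solution. -/
lemma tendsto_stieltjesSum {k x₀ : ℝ} (hk : 0 < k) {N : ℝ≥0 → ℕ} (hN : Monotone N) {J : ℕ → ℝ}
    {z x : ℝ≥0 → ℝ} (hz : ∀ t, z t = ∑ n ∈ Finset.range (N t), J n)
    (hint : ∀ t : ℝ≥0, IntervalIntegrable (fun u : ℝ => x u.toNNReal) volume 0 t)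
    (heq : ∀ t : ℝ≥0, x t = x₀ - k * (∫ u in (0 : ℝ)..t, x u.toNNReal) + z t) (s t : ℝ≥0) :
    Tendsto (fun n : ℕ => Real.exp (-k * t) * x s + ∑ j ∈ Finset.range n,
      Real.exp (-k * (t - t * (j + 1 : ℕ) / n)) *
        (z (s + t * (j + 1 : ℕ) / n) - z (s + t * (j : ℕ) / n))) atTop (𝓝 (x (s + t))) := by
  -- The path is bounded on `[0, s + t]`: the integral is continuous, and the driving path is at
  -- most the sum of the finitely many `|J n|`.
  obtain ⟨M, hM⟩ : ∃ M : ℝ, ∀ u ∈ Set.Icc (0 : ℝ) (s + t : ℝ≥0), |x u.toNNReal| ≤ M := by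
    have hI := intervalIntegral.continuousOn_primitive_interval' (hint (s + t)) Set.left_mem_uIcc
    rw [Set.uIcc_of_le (NNReal.coe_nonneg _)] at hI
    obtain ⟨C, hC⟩ := isCompact_Icc.exists_bound_of_continuousOn hI
    refine ⟨|x₀| + k * C + ∑ n ∈ Finset.range (N (s + t)), |J n|, fun u hu => ?_⟩
    have hu' : u.toNNReal ≤ s + t := Real.toNNReal_le_iff_le_coe.2 hu.2
    rw [heq, Real.coe_toNNReal u hu.1, hz]
    refine (abs_add_le _ _).trans (add_le_add ((abs_sub _ _).trans (add_le_add le_rfl ?_)) ?_)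
    · rw [abs_mul, abs_of_pos hk]
      exact mul_le_mul_of_nonneg_left (hC u hu) hk.le
    · refine (Finset.abs_sum_le_sum_abs _ _).trans (Finset.sum_le_sum_of_subset_of_nonneg ?_
        fun _ _ _ => abs_nonneg _)
      exact Finset.range_subset_range.2 (hN hu')
  have hM0 : 0 ≤ M := (abs_nonneg _).trans (hM 0 ⟨le_rfl, NNReal.coe_nonneg _⟩)
  -- Without a jump in `(a, b]` the decay is exact and the error zero; otherwise the error is `O(b -
  -- a)` and `N b - N a ≥ 1`. The factor `N b - N a` covers both cases and telescopes, so the total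
  -- error is `O(1 / n)`.
  have hloc : ∀ a b : ℝ≥0, a ≤ b → b ≤ s + t →
      |x b - Real.exp (-k * (b - a)) * x a - (z b - z a)| ≤
        2 * k * M * (b - a) * ((N b : ℝ) - N a) := by
    intro a b hab hb
    have hab' : (a : ℝ) ≤ b := hab
    have hb' : (b : ℝ) ≤ (s + t : ℝ≥0) := hb
    rcases (hN hab).eq_or_lt with h | h
    · have hzc : ∀ u ∈ Set.Icc (a : ℝ) b, z u.toNNReal = z (a : ℝ).toNNReal := fun u hu => by
        have h1 : a ≤ u.toNNReal := by
          rw [← Real.toNNReal_coe (r := a)]; exact Real.toNNReal_mono hu.1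
        have h2 : u.toNNReal ≤ b := Real.toNNReal_le_iff_le_coe.2 hu.2
        rw [Real.toNNReal_coe, hz, hz, le_antisymm ((hN h2).trans h.ge) (hN h1)]
      have := eq_exp_mul_of_const (z := fun u => z u.toNNReal) a.2 hab' (hint b)
        (fun u hu => by rw [heq u.toNNReal, Real.coe_toNNReal u (a.2.trans hu.1)]) hzc
      simp only [Real.toNNReal_coe] at this
      rw [this, hz, hz, h]
      simp
    · have h1 : x b - x a - (z b - z a) = -k * ∫ u in (a : ℝ)..b, x u.toNNReal := by
        rw [← intervalIntegral.integral_interval_sub_left (hint b) (hint a), heq b, heq a]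
        ring
      have h2 : |∫ u in (a : ℝ)..b, x u.toNNReal| ≤ M * (b - a) := by
        have := intervalIntegral.norm_integral_le_of_norm_le_const (a := (a : ℝ)) (b := b) (C := M)
          (f := fun u => x u.toNNReal) (fun u hu => by
            rw [Set.uIoc_of_le hab'] at hu
            exact hM u ⟨a.2.trans hu.1.le, hu.2.trans hb'⟩)
        rwa [abs_of_nonneg (sub_nonneg.2 hab')] at this
      have h3 : |x a| ≤ M := by simpa using hM a ⟨a.2, hab'.trans hb'⟩
      have h4 : 1 - Real.exp (-k * (b - a)) ≤ k * (b - a) := by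
        linarith [Real.add_one_le_exp (-k * ((b : ℝ) - a))]
      have h5 : 0 ≤ 1 - Real.exp (-k * (b - a)) := by
        rw [sub_nonneg, Real.exp_le_one_iff]; nlinarith
      have h6 : (1 : ℝ) ≤ (N b : ℝ) - N a := by
        have : (N a : ℝ) + 1 ≤ N b := by exact_mod_cast h
        linarith
      calc |x b - Real.exp (-k * (b - a)) * x a - (z b - z a)|
          = |-k * (∫ u in (a : ℝ)..b, x u.toNNReal) + (1 - Real.exp (-k * (b - a))) * x a| := by
            rw [← h1]; ring_nf
        _ ≤ k * (M * (b - a)) + k * (b - a) * M := by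
            refine (abs_add_le _ _).trans (add_le_add ?_ ?_)
            · rw [abs_mul, abs_neg, abs_of_pos hk]
              exact mul_le_mul_of_nonneg_left h2 hk.le
            · rw [abs_mul, abs_of_nonneg h5]
              exact mul_le_mul h4 h3 (abs_nonneg _) (mul_nonneg hk.le (sub_nonneg.2 hab'))
        _ = 2 * k * M * (b - a) * 1 := by ring
        _ ≤ 2 * k * M * (b - a) * ((N b : ℝ) - N a) :=
            mul_le_mul_of_nonneg_left h6 (mul_nonneg (by positivity) (sub_nonneg.2 hab'))
  have hlim : Tendsto (fun n : ℕ => 2 * k * M * ((N (s + t) : ℝ) - N s) * t * (n : ℝ)⁻¹) atTop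
      (𝓝 0) := by
    simpa using (tendsto_inv_atTop_nhds_zero_nat (𝕜 := ℝ)).const_mul
      (2 * k * M * ((N (s + t) : ℝ) - N s) * t)
  rw [tendsto_iff_dist_tendsto_zero]
  refine squeeze_zero' (Eventually.of_forall fun _ => dist_nonneg) ?_ hlim
  filter_upwards [eventually_ge_atTop 1] with n hn
  have hn0 : (n : ℝ≥0) ≠ 0 := by exact_mod_cast (by omega : n ≠ 0)
  have hn0' : (0 : ℝ) < n := by exact_mod_cast hn
  let τ : ℕ → ℝ≥0 := fun j => s + t * (j : ℕ) / n
  have hτ0 : τ 0 = s := by simp [τ]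
  have hτn : τ n = s + t := by simp [τ, hn0]
  have hτm : Monotone τ := fun i j hij => by
    simp only [τ]; gcongr
  have hτd : ∀ j, ((τ (j + 1) : ℝ≥0) : ℝ) - τ j = t * (n : ℝ)⁻¹ := fun j => by
    simp only [τ]; push_cast; ring
  let w : ℕ → ℝ := fun j => Real.exp (-k * (t - t * (j : ℕ) / n))
  have hw1 : ∀ j, w (j + 1) * Real.exp (-k * (t * (n : ℝ)⁻¹)) = w j := fun j => by
    simp only [w]; rw [← Real.exp_add]; congr 1; push_cast; ring
  have hwle : ∀ j ∈ Finset.range n, w (j + 1) ≤ 1 := fun j hj => by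
    have hj' : ((j + 1 : ℕ) : ℝ) ≤ n := by exact_mod_cast Finset.mem_range.1 hj
    have : (t : ℝ) * (j + 1 : ℕ) / n ≤ t := by
      rw [div_le_iff₀ hn0']
      exact mul_le_mul_of_nonneg_left hj' t.2
    simp only [w]
    rw [Real.exp_le_one_iff]
    nlinarith
  have htel : x (s + t) - Real.exp (-k * t) * x s =
      ∑ j ∈ Finset.range n, (w (j + 1) * x (τ (j + 1)) - w j * x (τ j)) := by
    rw [Finset.sum_range_sub (fun j => w j * x (τ j)), hτ0, hτn]
    simp [w, hn0'.ne']
  rw [dist_comm, Real.dist_eq, ← sub_sub, htel, ← Finset.sum_sub_distrib]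
  calc _ ≤ ∑ j ∈ Finset.range n, 2 * k * M * (t * (n : ℝ)⁻¹) *
        ((N (τ (j + 1)) : ℝ) - N (τ j)) := by
        refine Finset.abs_sum_le_sum_abs _ _ |>.trans (Finset.sum_le_sum fun j hj => ?_)
        have := hloc (τ j) (τ (j + 1)) (hτm (Nat.le_succ j))
          (hτn ▸ hτm (Finset.mem_range.1 hj))
        rw [hτd] at this
        refine le_trans ?_ this
        have e : w (j + 1) * x (τ (j + 1)) - w j * x (τ j) -
            w (j + 1) * (z (τ (j + 1)) - z (τ j)) = w (j + 1) * (x (τ (j + 1)) -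
              Real.exp (-k * (t * (n : ℝ)⁻¹)) * x (τ j) - (z (τ (j + 1)) - z (τ j))) := by
          rw [← hw1 j]; ring
        change |w (j + 1) * x (τ (j + 1)) - w j * x (τ j) -
            w (j + 1) * (z (τ (j + 1)) - z (τ j))| ≤ _
        rw [e, abs_mul, abs_of_pos (Real.exp_pos _)]
        exact mul_le_of_le_one_left (abs_nonneg _) (hwle j hj)
    _ = 2 * k * M * ((N (s + t) : ℝ) - N s) * t * (n : ℝ)⁻¹ := by
        rw [← Finset.mul_sum, Finset.sum_range_sub (fun j => (N (τ j) : ℝ)), hτ0, hτn]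
        ring

/-! ### Characteristic functions of compound Poisson increments. -/

/-- A sum of weighted consecutive blocks is a single weighted sum. -/
lemma exists_weights (φ : ℝ → ℂ) (hφ : φ 0 = 1) (c : ℕ → ℝ) {n : ℕ → ℕ} (m : ℕ)
    (hn : ∀ j < m, n j ≤ n (j + 1)) :
    ∃ a : ℕ → ℝ,
      (∀ x : ℕ → ℝ, ∑ j ∈ Finset.range m, c j *
        (∑ i ∈ Finset.range (n (j + 1)), x i - ∑ i ∈ Finset.range (n j), x i) =
          ∑ i ∈ Finset.range (n m), a i * x i) ∧
      ∏ j ∈ Finset.range m, φ (c j) ^ (n (j + 1) - n j) = ∏ i ∈ Finset.range (n m), φ (a i) := by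
  induction m with
  | zero => exact ⟨0, by simp [hφ]⟩
  | succ m ih =>
    obtain ⟨a, ha, hb⟩ := ih fun j hj => hn j (hj.trans (Nat.lt_succ_self m))
    have hm := hn m (Nat.lt_succ_self m)
    have h1 : ∀ i ∈ Finset.range (n m), (if i < n m then a i else c m) = a i := fun i hi =>
      if_pos (Finset.mem_range.1 hi)
    have h2 : ∀ i ∈ Finset.Ico (n m) (n (m + 1)), (if i < n m then a i else c m) = c m :=
      fun i hi => if_neg (not_lt.2 (Finset.mem_Ico.1 hi).1)
    refine ⟨fun i => if i < n m then a i else c m, fun x => ?_, ?_⟩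
    · refine Eq.trans ?_ (Finset.sum_range_add_sum_Ico
        (fun i => (if i < n m then a i else c m) * x i) hm)
      rw [Finset.sum_range_succ, ha, ← Finset.sum_range_add_sum_Ico x hm, add_sub_cancel_left,
        Finset.mul_sum]
      exact congrArg₂ _ (Finset.sum_congr rfl fun i hi => by rw [h1 i hi])
        (Finset.sum_congr rfl fun i hi => by rw [h2 i hi])
    · refine Eq.trans ?_ (Finset.prod_range_mul_prod_Ico
        (fun i => φ (if i < n m then a i else c m)) hm)
      rw [Finset.prod_range_succ, hb, Finset.prod_congr rfl fun i hi => congrArg φ (h1 i hi),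
        Finset.prod_congr rfl fun i hi => congrArg φ (h2 i hi), Finset.prod_const, Nat.card_Ico]

variable {Ω : Type*} [MeasurableSpace Ω] {μ : Measure Ω}

lemma integral_exp_weightedSum {ν : Measure ℝ} {J : ℕ → Ω → ℝ} (hJ : ∀ n, HasLaw (J n) ν μ)
    (hind : iIndepFun J μ) (a : ℕ → ℝ) (n : ℕ) :
    ∫ ω, Complex.exp (Complex.I * (∑ i ∈ Finset.range n, a i * J i ω : ℝ)) ∂μ =
      ∏ i ∈ Finset.range n, charFun ν (a i) := by
  have h := (hind.precomp (g := fun i : Fin n => (i : ℕ)) Fin.val_injective).integral_fun_prod_comp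
    (f := fun (i : Fin n) x => Complex.exp (Complex.I * (a i * x : ℝ)))
    (fun i => (hJ i).aemeasurable) (fun i => by fun_prop)
  have hi : ∀ i : Fin n, ∫ ω, Complex.exp (Complex.I * (a i * J i ω : ℝ)) ∂μ =
      charFun ν (a i) := fun i => by
    rw [charFun_apply_real, ← (hJ i).map_eq, integral_map (hJ i).aemeasurable (by fun_prop)]
    refine integral_congr_ae (ae_of_all _ fun ω => ?_)
    simp only [Complex.ofReal_mul]
    ring_nf
  rw [Finset.prod_range, ← Finset.prod_congr rfl fun i _ => hi i, ← h]
  refine integral_congr_ae (ae_of_all _ fun ω => ?_)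
  simp only
  rw [← Complex.exp_sum, ← Finset.mul_sum, ← Complex.ofReal_sum, Finset.sum_range]

lemma integral_pow_poissonMeasure (r : ℝ≥0) (z : ℂ) :
    ∫ n, z ^ n ∂(poissonMeasure r) = Complex.exp (r * (z - 1)) := by
  rw [integral_poissonMeasure]
  have h := (NormedSpace.expSeries_div_hasSum_exp ((r : ℂ) * z)).mul_left (Complex.exp (-r))
  rw [← Complex.exp_eq_exp_ℂ, ← Complex.exp_add] at h
  rw [mul_sub, mul_one, sub_eq_neg_add, ← h.tsum_eq]
  refine tsum_congr fun n => ?_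
  rw [Complex.real_smul]
  push_cast
  ring

lemma IsPoissonProcess.integral_prod_pow [IsProbabilityMeasure μ] {lam : ℝ≥0} {N : ℝ≥0 → Ω → ℕ}
    (hN : IsPoissonProcess lam N μ) (z : ℕ → ℂ) {τ : ℕ → ℝ≥0} (hτ : Monotone τ) (m : ℕ) :
    ∫ ω, ∏ j ∈ Finset.range m, z j ^ (N (τ (j + 1)) ω - N (τ j) ω) ∂μ =
      ∏ j ∈ Finset.range m,
        Complex.exp ((lam * ((τ (j + 1) : ℝ) - τ j) : ℝ) * (z j - 1)) := by
  -- Independence and laws are given for real-valued increments; the floor recovers the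
  -- natural-number exponent.
  have hmeas : ∀ w : ℂ, Measurable fun x : ℝ => w ^ ⌊x⌋₊ := fun w =>
    (measurable_from_nat (f := fun n => w ^ n)).comp Nat.measurable_floor
  have h := ((hN.indep.nat hτ).precomp (g := fun i : Fin m => (i : ℕ))
    Fin.val_injective).integral_fun_prod_comp
    (f := fun (i : Fin m) x => z i ^ ⌊x⌋₊)
    (fun i => (hN.law _ _ (hτ (Nat.le_succ i))).aemeasurable)
    (fun i => (hmeas (z i)).aestronglyMeasurable)
  rw [Finset.prod_range]
  calc _ = ∫ ω, ∏ i : Fin m, z i ^ ⌊(N (τ (i + 1)) ω : ℝ) - N (τ i) ω⌋₊ ∂μ := by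
        refine integral_congr_ae ?_
        filter_upwards [hN.mono] with ω hω
        rw [Finset.prod_range]
        refine Finset.prod_congr rfl fun i _ => ?_
        rw [← Nat.cast_sub (hω (hτ (Nat.le_succ i))), Nat.floor_natCast]
    _ = _ := by
        rw [h]
        refine Finset.prod_congr rfl fun i _ => ?_
        have hle := hτ (Nat.le_succ (i : ℕ))
        have hl := (hN.law _ _ hle).integral_comp (f := fun x => z i ^ ⌊x⌋₊)
          (hmeas (z i)).aestronglyMeasurable
        rw [integral_map Measurable.of_discrete.aemeasurable
          (hmeas (z i)).aestronglyMeasurable] at hl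
        simp only [Nat.floor_natCast, integral_pow_poissonMeasure] at hl
        refine Eq.trans hl ?_
        rw [NNReal.coe_mul, NNReal.coe_sub hle]

/-- The joint characteristic function of the increments of a compound Poisson process. -/
lemma IsCompoundPoisson.integral_exp_increments [IsProbabilityMeasure μ] {lam : ℝ≥0}
    {ν : Measure ℝ} {Z : ℝ≥0 → Ω → ℝ} (hZ : IsCompoundPoisson lam ν Z μ) (c : ℕ → ℝ)
    {τ : ℕ → ℝ≥0} (hτ : Monotone τ) (m : ℕ) :
    ∫ ω, Complex.exp (Complex.I *
        (∑ j ∈ Finset.range m, c j * (Z (τ (j + 1)) ω - Z (τ j) ω) : ℝ)) ∂μ =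
      ∏ j ∈ Finset.range m,
        Complex.exp ((lam * ((τ (j + 1) : ℝ) - τ j) : ℝ) * (charFun ν (c j) - 1)) := by
  obtain ⟨N, J, hN, hJm, hJ, hJi, hJN, hrep⟩ := hZ.exists_repr
  have hν : IsProbabilityMeasure ν := (hJ 0).isProbabilityMeasure_iff.1 inferInstance
  -- Only finitely many times matter. Counts at these times live in a countable space, so
  -- measurability of `F` below may be checked for each fixed value of the counts.
  let K : Ω → Fin (m + 1) → ℕ := fun ω j => N (τ j) ω
  have hK : Measurable K := measurable_pi_lambda _ fun j => hN.measurable _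
  have hJ' : Measurable fun ω n => J n ω := measurable_pi_lambda _ hJm
  have hind : IndepFun (fun ω n => J n ω) K μ :=
    hJN.comp (φ := id) (ψ := fun (f : ℝ≥0 → ℕ) (j : Fin (m + 1)) => f (τ j)) measurable_id
      (measurable_pi_lambda _ fun j => measurable_pi_apply _)
  -- Indices wrap modulo `m + 1`; only those up to `m` are used.
  let e : (Fin (m + 1) → ℕ) → ℕ → ℕ := fun n j => n (Fin.ofNat (m + 1) j)
  have he : ∀ ω, ∀ j ≤ m, e (K ω) j = N (τ j) ω := fun ω j hj => by
    simp only [e, K, Fin.ofNat, Nat.mod_eq_of_lt (Nat.lt_succ_of_le hj)]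
  let F : (ℕ → ℝ) × (Fin (m + 1) → ℕ) → ℂ := fun q => Complex.exp (Complex.I *
    (∑ j ∈ Finset.range m, c j * (∑ i ∈ Finset.range (e q.2 (j + 1)), q.1 i -
      ∑ i ∈ Finset.range (e q.2 j), q.1 i) : ℝ))
  have hF : Measurable F := measurable_from_prod_countable_left fun n => by
    simp only [F]; fun_prop
  have hFb : ∀ q, ‖F q‖ = 1 := fun q => by
    simp only [F]; rw [mul_comm, Complex.norm_exp_ofReal_mul_I]
  have hprod := (indepFun_iff_map_prod_eq_prod_map_map hJ'.aemeasurable hK.aemeasurable).1 hind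
  have := Measure.isProbabilityMeasure_map (μ := μ) hJ'.aemeasurable
  have := Measure.isProbabilityMeasure_map (μ := μ) hK.aemeasurable
  calc _ = ∫ ω, F (fun n => J n ω, K ω) ∂μ := by
        refine integral_congr_ae ?_
        filter_upwards [hrep] with ω hω
        simp only [F]
        congr 3
        refine Finset.sum_congr rfl fun j hj => ?_
        have hj := Finset.mem_range.1 hj
        rw [hω, hω, he ω j hj.le, he ω (j + 1) hj]
    _ = ∫ q, F q ∂(μ.map fun ω => (fun n => J n ω, K ω)) :=
        (integral_map (hJ'.prodMk hK).aemeasurable hF.aestronglyMeasurable).symm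
    _ = ∫ n, ∫ x, F (x, n) ∂(μ.map fun ω n => J n ω) ∂(μ.map K) := by
        rw [hprod, integral_prod_symm]
        exact Integrable.of_bound hF.aestronglyMeasurable 1 (ae_of_all _ fun q => (hFb q).le)
    -- With the counts frozen, the inner integral is over a fixed finite weighted sum of i.i.d.
    -- jumps.
    _ = ∫ ω, ∫ ω', F (fun n => J n ω', K ω) ∂μ ∂μ := by
        rw [integral_map hK.aemeasurable
          (Measurable.of_discrete).aestronglyMeasurable]
        refine integral_congr_ae (ae_of_all _ fun ω => ?_)
        exact integral_map hJ'.aemeasurable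
          (hF.comp measurable_prodMk_right).aestronglyMeasurable
    _ = ∫ ω, ∏ j ∈ Finset.range m, charFun ν (c j) ^ (N (τ (j + 1)) ω - N (τ j) ω) ∂μ := by
        refine integral_congr_ae ?_
        filter_upwards [hN.mono] with ω hω
        obtain ⟨a, ha, hb⟩ := exists_weights (charFun ν) (by simp) c (n := e (K ω)) m
          (fun j hj => by
            rw [he ω j hj.le, he ω (j + 1) hj]; exact hω (hτ (Nat.le_succ j)))
        simp only [F, ha]
        rw [integral_exp_weightedSum hJ hJi, ← hb]
        refine Finset.prod_congr rfl fun j hj => ?_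
        have hj := Finset.mem_range.1 hj
        rw [he ω j hj.le, he ω (j + 1) hj]
    _ = _ := hN.integral_prod_pow _ hτ m

/-- The joint characteristic function of a variable independent of a compound Poisson process and
increments of the latter. -/
lemma IsCompoundPoisson.integral_exp_add_increments [IsProbabilityMeasure μ] {lam : ℝ≥0}
    {ν : Measure ℝ} {Z : ℝ≥0 → Ω → ℝ} (hZ : IsCompoundPoisson lam ν Z μ) {X₀ : Ω → ℝ}
    (hX₀ : Measurable X₀) (hind : IndepFun X₀ (fun ω t => Z t ω) μ) (u : ℝ) (c : ℕ → ℝ)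
    {τ : ℕ → ℝ≥0} (hτ : Monotone τ) (m : ℕ) :
    ∫ ω, Complex.exp (Complex.I *
        (u * X₀ ω + ∑ j ∈ Finset.range m, c j * (Z (τ (j + 1)) ω - Z (τ j) ω) : ℝ)) ∂μ =
      charFun (μ.map X₀) u * ∏ j ∈ Finset.range m,
        Complex.exp ((lam * ((τ (j + 1) : ℝ) - τ j) : ℝ) * (charFun ν (c j) - 1)) := by
  have hmZ := hZ.measurable
  have hind' : IndepFun X₀
      (fun ω => ∑ j ∈ Finset.range m, c j * (Z (τ (j + 1)) ω - Z (τ j) ω)) μ :=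
    hind.comp (φ := id)
      (ψ := fun f : ℝ≥0 → ℝ => ∑ j ∈ Finset.range m, c j * (f (τ (j + 1)) - f (τ j))) measurable_id
      (by fun_prop)
  have h := hind'.integral_fun_comp_mul_comp (f := fun x : ℝ => Complex.exp (Complex.I * (u * x)))
    (g := fun x : ℝ => Complex.exp (Complex.I * x)) hX₀.aemeasurable (by fun_prop)
    (by fun_prop) (by fun_prop)
  rw [← hZ.integral_exp_increments c hτ m, charFun_apply_real,
    integral_map hX₀.aemeasurable (by fun_prop)]
  simp_rw [mul_comm _ Complex.I]
  rw [← h]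
  refine integral_congr_ae (ae_of_all _ fun ω => ?_)
  simp only
  rw [← Complex.exp_add, Complex.ofReal_add, mul_add, Complex.ofReal_mul]

/-! ### Passage to the limit in the joint characteristic function. -/

lemma tendsto_rightRiemannSum {G f : ℝ → ℂ} (hG : ∀ r, HasDerivAt G (f r) r) (hf : Continuous f)
    {t : ℝ} (ht : 0 ≤ t) :
    Tendsto (fun n : ℕ => ∑ j ∈ Finset.range n, ((t / n : ℝ) : ℂ) * f (t - t * (j + 1 : ℕ) / n))
      atTop (𝓝 (G t - G 0)) := by
  refine (tendsto_leftRiemannSum hG hf ht).congr fun n => ?_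
  rw [← Finset.sum_range_reflect]
  refine Finset.sum_congr rfl fun j hj => ?_
  have hj := Finset.mem_range.1 hj
  have hn : (n : ℝ) ≠ 0 := by exact_mod_cast (by omega : n ≠ 0)
  congr 2
  rw [Nat.sub_sub, Nat.add_comm 1 j, Nat.cast_sub hj, mul_sub, sub_div, mul_div_assoc, div_self hn,
    mul_one]

lemma tendsto_integral_exp_I_mul [IsFiniteMeasure μ] {A : ℕ → Ω → ℝ} {B : Ω → ℝ}
    (hA : ∀ n, Measurable (A n)) (h : ∀ᵐ ω ∂μ, Tendsto (fun n => A n ω) atTop (𝓝 (B ω))) :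
    Tendsto (fun n => ∫ ω, Complex.exp (Complex.I * (A n ω : ℝ)) ∂μ) atTop
      (𝓝 (∫ ω, Complex.exp (Complex.I * (B ω : ℝ)) ∂μ)) := by
  refine tendsto_integral_of_dominated_convergence (fun _ => 1)
    (fun n => by have := hA n; fun_prop) (integrable_const 1)
    (fun n => ae_of_all _ fun ω => by rw [mul_comm, Complex.norm_exp_ofReal_mul_I]) ?_
  filter_upwards [h] with ω hω
  have hc : Continuous fun x : ℝ => Complex.exp (Complex.I * x) := by fun_prop
  exact (hc.tendsto _).comp hω

/-- The joint characteristic function of `X s` and `X (s + t) - exp (-k t) X s`. -/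
lemma IsOUSolution.integral_exp [IsProbabilityMeasure μ] {k : ℝ} (hk : 0 < k) {lam : ℝ≥0}
    {ν : Measure ℝ} [IsProbabilityMeasure ν] {X₀ : Ω → ℝ} {Z X : ℝ≥0 → Ω → ℝ}
    (hZ : IsCompoundPoisson lam ν Z μ) (hX : IsOUSolution k X₀ Z X μ) {G : ℝ → ℝ → ℂ}
    (hG : ∀ v r, HasDerivAt (G v) (((lam : ℝ) : ℂ) * (charFun ν (v * Real.exp (-k * r)) - 1)) r)
    (s t : ℝ≥0) (u v : ℝ) :
    ∫ ω, Complex.exp (Complex.I *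
        (u * X s ω + v * (X (s + t) ω - Real.exp (-k * t) * X s ω) : ℝ)) ∂μ =
      charFun (μ.map X₀) (u * Real.exp (-k * s)) *
        (Complex.exp (G u s - G u 0) * Complex.exp (G v t - G v 0)) := by
  have hmZ := hZ.measurable
  have hmX₀ := hX.measurable_init
  -- One grid of `n` cells on `[0, s]` followed by `n` cells on `[s, s + t]`. Truncated subtraction
  -- keeps the second term zero for `j ≤ n`, and `min` freezes the first at `s` afterwards.
  let τ : ℕ → ℕ → ℝ≥0 := fun n j => s * (min j n : ℕ) / n + t * (j - n : ℕ) / n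
  let c : ℕ → ℕ → ℝ := fun n j => if j < n then u * Real.exp (-k * (s - s * (j + 1 : ℕ) / n))
    else v * Real.exp (-k * (t - t * (j - n + 1 : ℕ) / n))
  have hτm : ∀ n, Monotone (τ n) := fun n i j hij => by
    simp only [τ]; gcongr
  have hτ₁ : ∀ n j, j ≤ n → τ n j = s * (j : ℕ) / n := fun n j hj => by
    simp only [τ]
    rw [min_eq_left hj, Nat.sub_eq_zero_of_le hj, Nat.cast_zero, mul_zero, zero_div, add_zero]
  have hτ₂ : ∀ n j, 1 ≤ n → τ n (n + j) = s + t * (j : ℕ) / n := fun n j hn => by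
    have : (n : ℝ≥0) ≠ 0 := by exact_mod_cast (by omega : n ≠ 0)
    simp [τ, this]
  have hc₁ : ∀ n j, j < n → c n j = u * Real.exp (-k * (s - s * (j + 1 : ℕ) / n)) :=
    fun n j hj => if_pos hj
  have hc₂ : ∀ n j, c n (n + j) = v * Real.exp (-k * (t - t * (j + 1 : ℕ) / n)) := fun n j => by
    simp [c]
  let A : ℕ → Ω → ℝ := fun n ω => u * Real.exp (-k * s) * X₀ ω +
    ∑ j ∈ Finset.range (n + n), c n j * (Z (τ n (j + 1)) ω - Z (τ n j) ω)
  have hA : ∀ᵐ ω ∂μ, Tendsto (fun n => A n ω) atTop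
      (𝓝 (u * X s ω + v * (X (s + t) ω - Real.exp (-k * t) * X s ω))) := by
    obtain ⟨N, J, hN, -, -, -, -, hrep⟩ := hZ.exists_repr
    filter_upwards [hN.mono, hN.zero, hrep, hX.integrable, hX.eq] with ω hm h0 hz hint heq
    have h1 := tendsto_stieltjesSum hk hm hz hint heq 0 s
    have h2 := tendsto_stieltjesSum hk hm hz hint heq s t
    have hX0 : X 0 ω = X₀ ω := by rw [heq 0, hz 0, h0]; simp
    rw [zero_add, hX0] at h1
    have h := (h1.const_mul u).add ((h2.sub_const (Real.exp (-k * t) * X s ω)).const_mul v)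
    refine h.congr' ?_
    filter_upwards [eventually_ge_atTop 1] with n hn
    simp only [A]
    rw [Finset.sum_range_add, add_sub_cancel_left, mul_add, Finset.mul_sum, Finset.mul_sum,
      ← mul_assoc, add_assoc]
    congr 2
    · refine Finset.sum_congr rfl fun j hj => ?_
      have hj := Finset.mem_range.1 hj
      rw [hc₁ n j hj, hτ₁ n j hj.le, hτ₁ n (j + 1) hj, zero_add, zero_add, mul_assoc]
    · refine Finset.sum_congr rfl fun j _ => ?_
      rw [hc₂ n j, hτ₂ n j hn, add_assoc n j 1, hτ₂ n (j + 1) hn, mul_assoc]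
  have hlim := tendsto_integral_exp_I_mul (fun n => by simp only [A]; fun_prop) hA
  refine tendsto_nhds_unique hlim ?_
  have hR : ∀ (w : ℝ) (r : ℝ≥0), Tendsto (fun n : ℕ => ∑ j ∈ Finset.range n, ((r / n : ℝ) : ℂ) *
      (((lam : ℝ) : ℂ) * (charFun ν (w * Real.exp (-k * (r - r * (j + 1 : ℕ) / n))) - 1)))
        atTop (𝓝 (G w r - G w 0)) := fun w r =>
    tendsto_rightRiemannSum (hG w) (continuous_charFun_mul_exp_sub_one w) r.2
  have hexp : ∀ (w : ℝ) (r : ℝ≥0), _ := fun w r => (Complex.continuous_exp.tendsto _).comp (hR w r)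
  refine (((hexp u s).mul (hexp v t)).const_mul _).congr' ?_
  filter_upwards [eventually_ge_atTop 1] with n hn
  simp only [A, Function.comp_apply]
  rw [hZ.integral_exp_add_increments hmX₀ hX.indep_init _ _ (hτm n), Finset.prod_range_add,
    Complex.exp_sum, Complex.exp_sum]
  congr 2
  · refine Finset.prod_congr rfl fun j hj => ?_
    have hj := Finset.mem_range.1 hj
    rw [hc₁ n j hj, hτ₁ n j hj.le, hτ₁ n (j + 1) hj]
    congr 1
    push_cast
    ring
  · refine Finset.prod_congr rfl fun j _ => ?_
    rw [hc₂ n j, hτ₂ n j hn, add_assoc n j 1, hτ₂ n (j + 1) hn]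
    congr 1
    push_cast
    ring

/-! ### Independence and conditional expectation. -/

lemma charFun_map_eq_integral {Y : Ω → ℝ} (hY : Measurable Y) (v : ℝ) :
    charFun (μ.map Y) v = ∫ ω, Complex.exp (Complex.I * (v * Y ω : ℝ)) ∂μ := by
  rw [charFun_apply_real, integral_map hY.aemeasurable (by fun_prop)]
  refine integral_congr_ae (ae_of_all _ fun ω => ?_)
  simp only [Complex.ofReal_mul]
  ring_nf

/-- Setting one variable to `0` identifies `a` and `b` as the marginal characteristic functions, so
the joint one is their product. -/
lemma indepFun_of_integral_exp [IsProbabilityMeasure μ] {Y W : Ω → ℝ} (hY : Measurable Y)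
    (hW : Measurable W) {a b : ℝ → ℂ} (ha : a 0 = 1) (hb : b 0 = 1)
    (h : ∀ u v : ℝ, ∫ ω, Complex.exp (Complex.I * (u * Y ω + v * W ω : ℝ)) ∂μ = a u * b v) :
    IndepFun Y W μ := by
  rw [indepFun_iff_charFun_prod hY.aemeasurable hW.aemeasurable]
  intro q
  have h1 : charFun (μ.map Y) q.ofLp.1 = a q.ofLp.1 := by
    rw [charFun_map_eq_integral hY, ← mul_one (a _), ← hb, ← h]; simp
  have h2 : charFun (μ.map W) q.ofLp.2 = b q.ofLp.2 := by
    rw [charFun_map_eq_integral hW, ← one_mul (b _), ← ha, ← h]; simp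
  rw [h1, h2, ← h, charFun_apply, integral_map (by fun_prop) (by fun_prop)]
  refine integral_congr_ae (ae_of_all _ fun ω => ?_)
  simp only [WithLp.prod_inner_apply, Real.inner_apply]
  rw [mul_comm _ Complex.I, mul_comm (Y ω), mul_comm (W ω)]

lemma condExp_exp_of_indepFun [IsProbabilityMeasure μ] {Y W : Ω → ℝ} (hY : Measurable Y)
    (hW : Measurable W) (h : IndepFun Y W μ) (v a : ℝ) :
    μ[fun ω => Complex.exp (Complex.I * v * (Y ω * a)) * Complex.exp (Complex.I * (v * W ω : ℝ)) |
        MeasurableSpace.comap Y inferInstance] =ᵐ[μ]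
      fun ω => Complex.exp (Complex.I * v * (Y ω * a)) *
        ∫ ω, Complex.exp (Complex.I * (v * W ω : ℝ)) ∂μ := by
  have hWi : Integrable (fun ω => Complex.exp (Complex.I * (v * W ω : ℝ))) μ :=
    Integrable.of_bound (by fun_prop) 1
      (ae_of_all _ fun ω => by rw [mul_comm, Complex.norm_exp_ofReal_mul_I])
  have hYm : Measurable[MeasurableSpace.comap Y inferInstance] Y := comap_measurable Y
  have hYs : StronglyMeasurable[MeasurableSpace.comap Y inferInstance]
      fun ω => Complex.exp (Complex.I * v * (Y ω * a)) := by
    have : Measurable fun y : ℝ => Complex.exp (Complex.I * v * (y * a)) := by fun_prop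
    exact (this.comp hYm).stronglyMeasurable
  have hWs : StronglyMeasurable[MeasurableSpace.comap W inferInstance]
      fun ω => Complex.exp (Complex.I * (v * W ω : ℝ)) := by
    have : Measurable fun y : ℝ => Complex.exp (Complex.I * (v * y : ℝ)) := by fun_prop
    exact (this.comp (comap_measurable W)).stronglyMeasurable
  have h1 := condExp_bilin_of_stronglyMeasurable_left (μ := μ) (ContinuousLinearMap.mul ℝ ℂ) hYs
    (g := fun ω => Complex.exp (Complex.I * (v * W ω : ℝ)))
    (Integrable.of_bound (by simp only [ContinuousLinearMap.mul_apply']; fun_prop) 1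
      (ae_of_all _ fun ω => by
        simp [Complex.norm_exp])) hWi
  have h2 := condExp_indep_eq hW.comap_le hY.comap_le hWs ((IndepFun_iff_Indep W Y μ).1 h.symm)
  filter_upwards [h1, h2] with ω h1 h2
  simp only [ContinuousLinearMap.mul_apply'] at h1
  rw [h1, h2]

/-! ### Powers, the limit of the cumulant, and weak convergence. -/

lemma exp_cumulantPrimitive_sub {k lam p β₁ β₂ : ℝ} (hβ₁ : 0 < β₁) (hβ₂ : 0 < β₂) (v t : ℝ) :
    Complex.exp (cumulantPrimitive k lam p β₁ β₂ v t - cumulantPrimitive k lam p β₁ β₂ v 0) =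
      ((β₁ - Complex.I * v * Real.exp (-k * t)) / (β₁ - Complex.I * v)) ^
        ((p * lam / k : ℝ) : ℂ) *
      ((β₂ + Complex.I * v * Real.exp (-k * t)) / (β₂ + Complex.I * v)) ^
        (((1 - p) * lam / k : ℝ) : ℂ) := by
  have e : Complex.I * v * Real.exp (-k * t) = Complex.I * (v * Real.exp (-k * t) : ℝ) := by
    push_cast; ring
  rw [e, cpow_div_of_re_pos (re_sub_I_mul hβ₁ _) (re_sub_I_mul hβ₁ _),
    cpow_div_of_re_pos (re_add_I_mul hβ₂ _) (re_add_I_mul hβ₂ _), ← Complex.exp_add]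
  simp only [cumulantPrimitive, mul_zero, Real.exp_zero, mul_one]
  congr 1
  ring

/-- The limit of `cumulantPrimitive` at infinity. -/
noncomputable def cumulantLimit (k lam p β₁ β₂ : ℝ) : ℂ :=
  (p * lam / k : ℝ) * Complex.log β₁ + ((1 - p) * lam / k : ℝ) * Complex.log β₂

lemma tendsto_exp_neg_mul_nnreal {k : ℝ} (hk : 0 < k) (v : ℝ) :
    Tendsto (fun t : ℝ≥0 => v * Real.exp (-k * t)) atTop (𝓝 0) := by
  have h : Tendsto (fun t : ℝ≥0 => -k * (t : ℝ)) atTop atBot :=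
    NNReal.tendsto_coe_atTop.2 tendsto_id |>.const_mul_atTop_of_neg (neg_lt_zero.2 hk)
  simpa using (Real.tendsto_exp_atBot.comp h).const_mul v

lemma tendsto_cumulantPrimitive {k lam p β₁ β₂ : ℝ} (hk : 0 < k) (hβ₁ : 0 < β₁) (hβ₂ : 0 < β₂)
    (v : ℝ) :
    Tendsto (fun t : ℝ≥0 => cumulantPrimitive k lam p β₁ β₂ v t) atTop
      (𝓝 (cumulantLimit k lam p β₁ β₂)) := by
  have h : ContinuousAt (fun w : ℝ => ((p * lam / k : ℝ) : ℂ) * Complex.log (β₁ - Complex.I * w) +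
      ((1 - p) * lam / k : ℝ) * Complex.log (β₂ + Complex.I * w)) 0 := by
    refine (ContinuousAt.const_mul (ContinuousAt.clog (by fun_prop) ?_) _).add
      (ContinuousAt.const_mul (ContinuousAt.clog (by fun_prop) ?_) _)
    · exact Or.inl (re_sub_I_mul hβ₁ _)
    · exact Or.inl (re_add_I_mul hβ₂ _)
  simpa [cumulantPrimitive, cumulantLimit, Function.comp_def] using
    h.tendsto.comp (tendsto_exp_neg_mul_nnreal hk v)

/-- Expressing the candidate law through the same primitive as the transition factor reduces
invariance to a cancellation. -/
lemma charFun_bilateralGamma_mul_exp {k lam p β₁ β₂ : ℝ} (hk : 0 < k) (hlam : 0 < lam)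
    (hβ₁ : 0 < β₁) (hβ₂ : 0 < β₂) (hp₀ : 0 < p) (hp₁ : p < 1) (v t : ℝ) :
    charFun (bilateralGamma (p * lam / k) β₁ ((1 - p) * lam / k) β₂) (v * Real.exp (-k * t)) =
      Complex.exp (cumulantLimit k lam p β₁ β₂ - cumulantPrimitive k lam p β₁ β₂ v t) := by
  have := sub_pos.2 hp₁
  rw [charFun_bilateralGamma (by positivity) hβ₁ (by positivity) hβ₂, cumulantLimit,
    cumulantPrimitive]
  congr 1
  ring

/-- Laws of a net indexed by `ℝ≥0` whose characteristic functions converge converge weakly. -/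
lemma tendsto_integral_of_tendsto_charFun [IsProbabilityMeasure μ] {X : ℝ≥0 → Ω → ℝ}
    (hX : ∀ t, Measurable (X t)) {ρ : Measure ℝ} [IsProbabilityMeasure ρ]
    (h : ∀ v, Tendsto (fun t => charFun (μ.map (X t)) v) atTop (𝓝 (charFun ρ v))) (f : ℝ →ᵇ ℝ) :
    Tendsto (fun t => ∫ ω, f (X t ω) ∂μ) atTop (𝓝 (∫ x, f x ∂ρ)) := by
  -- `atTop` on `ℝ≥0` is countably generated, so Lévy's continuity theorem along sequences suffices.
  refine Filter.tendsto_of_seq_tendsto fun u hu => ?_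
  have hp := fun t => Measure.isProbabilityMeasure_map (μ := μ) (hX t).aemeasurable
  have hw := ProbabilityMeasure.tendsto_of_tendsto_charFun
    (μ := fun n => ⟨μ.map (X (u n)), hp (u n)⟩) (μ₀ := ⟨ρ, inferInstance⟩)
    fun v => (h v).comp hu
  refine (ProbabilityMeasure.tendsto_iff_forall_integral_tendsto.1 hw f).congr fun n => ?_
  exact integral_map (hX (u n)).aemeasurable f.continuous.aestronglyMeasurable

end BilateralGammaOU

/-! ### The transition formula and the stationary law. -/

theorem mainTheorem5 {Ω : Type*} [MeasurableSpace Ω] (μ : Measure Ω) [IsProbabilityMeasure μ]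
    (k : ℝ) (hk : 0 < k) (lam : ℝ≥0) (hlam : 0 < lam)
    (β₁ β₂ : ℝ) (hβ₁ : 0 < β₁) (hβ₂ : 0 < β₂) (p : ℝ) (hp₀ : 0 ≤ p) (hp₁ : p ≤ 1)
    (X₀ : Ω → ℝ) (Z X : ℝ≥0 → Ω → ℝ)
    (hZ : BilateralGammaOU.IsCompoundPoisson lam
      (BilateralGammaOU.doubleExponential p β₁ β₂) Z μ)
    (hX : BilateralGammaOU.IsOUSolution k X₀ Z X μ) :
    -- the conditional characteristic function of `X (t + s)` given `X s`
    (∀ (s t : ℝ≥0) (v : ℝ),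
      μ[fun ω => Complex.exp (Complex.I * v * X (t + s) ω) |
          MeasurableSpace.comap (X s) inferInstance]
        =ᵐ[μ] fun ω =>
          Complex.exp (Complex.I * v * X s ω * Real.exp (-k * t)) *
          ((β₁ - Complex.I * v * Real.exp (-k * t)) / (β₁ - Complex.I * v)) ^
            ((p * lam / k : ℝ) : ℂ) *
          ((β₂ + Complex.I * v * Real.exp (-k * t)) / (β₂ + Complex.I * v)) ^
            (((1 - p) * lam / k : ℝ) : ℂ)) ∧
    -- the stationary law
    (0 < p → p < 1 →
      -- the bilateral gamma law is invariant, and it is the only invariant law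
      ((∀ t, μ.map (X t) = μ.map X₀) ↔
        μ.map X₀ =
          BilateralGammaOU.bilateralGamma (p * lam / k) β₁ ((1 - p) * lam / k) β₂) ∧
      -- `X t` converges in law to it as `t → ∞`, whatever the law of `X₀`
      (∀ f : ℝ →ᵇ ℝ, Tendsto (fun t => ∫ ω, f (X t ω) ∂μ) atTop
        (𝓝 (∫ x, f x
          ∂(BilateralGammaOU.bilateralGamma (p * lam / k) β₁ ((1 - p) * lam / k) β₂))))) := by
  -- The total mass need not be computed: this measure is the law of `J 0`.
  have hν : IsProbabilityMeasure (BilateralGammaOU.doubleExponential p β₁ β₂) := by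
    obtain ⟨N, J, -, -, hJ, -⟩ := hZ.exists_repr
    exact (hJ 0).isProbabilityMeasure_iff.1 inferInstance
  have hlam' : (0 : ℝ) < lam := hlam
  let G : ℝ → ℝ → ℂ := BilateralGammaOU.cumulantPrimitive k lam p β₁ β₂
  have hjoint := hX.integral_exp hk hZ (G := G) fun v r =>
    BilateralGammaOU.hasDerivAt_cumulantPrimitive hk.ne' hβ₁ hβ₂ hp₀ hp₁ v r
  have hP₀ := Measure.isProbabilityMeasure_map (μ := μ) hX.measurable_init.aemeasurable
  have hchar : ∀ (t : ℝ≥0) (v : ℝ), charFun (μ.map (X t)) v =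
      charFun (μ.map X₀) (v * Real.exp (-k * t)) * Complex.exp (G v t - G v 0) := fun t v => by
    rw [BilateralGammaOU.charFun_map_eq_integral (hX.measurable t)]
    simpa using hjoint t 0 v 0
  refine ⟨fun s t v => ?_, fun hp₀ hp₁ => ?_⟩
  · have hmW : Measurable fun ω => X (t + s) ω - Real.exp (-k * t) * X s ω :=
      (hX.measurable _).sub ((hX.measurable s).const_mul _)
    have hind : IndepFun (X s) (fun ω => X (t + s) ω - Real.exp (-k * t) * X s ω) μ := by
      refine BilateralGammaOU.indepFun_of_integral_exp (hX.measurable s) hmW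
        (a := fun u => charFun (μ.map X₀) (u * Real.exp (-k * s)) * Complex.exp (G u s - G u 0))
        (b := fun v => Complex.exp (G v t - G v 0)) ?_ ?_ fun u v => ?_
      · simp [G, BilateralGammaOU.cumulantPrimitive]
      · simp [G, BilateralGammaOU.cumulantPrimitive]
      · rw [add_comm t s, hjoint, mul_assoc]
    have hW : ∫ ω, Complex.exp (Complex.I *
        (v * (X (t + s) ω - Real.exp (-k * t) * X s ω) : ℝ)) ∂μ =
          Complex.exp (G v t - G v 0) := by
      have h := hjoint s t 0 v
      rw [add_comm s t] at h
      simpa [G, BilateralGammaOU.cumulantPrimitive] using h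
    have h := BilateralGammaOU.condExp_exp_of_indepFun (hX.measurable s) hmW hind v
      (Real.exp (-k * t))
    rw [hW, BilateralGammaOU.exp_cumulantPrimitive_sub hβ₁ hβ₂] at h
    -- Split `X (t + s)` into `exp (-k t) X s` and the part independent of `X s`.
    have e : (fun ω => Complex.exp (Complex.I * v * X (t + s) ω)) = fun ω =>
        Complex.exp (Complex.I * v * (X s ω * Real.exp (-k * t))) *
          Complex.exp (Complex.I * (v * (X (t + s) ω - Real.exp (-k * t) * X s ω) : ℝ)) := by
      funext ω
      rw [← Complex.exp_add]
      push_cast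
      ring_nf
    rw [e]
    simpa only [mul_assoc] using h
  · have hp' := sub_pos.2 hp₁
    have hprob := BilateralGammaOU.isProbabilityMeasure_bilateralGamma
      (α₁ := p * lam / k) (α₂ := (1 - p) * lam / k) (by positivity) hβ₁ (by positivity) hβ₂
    have hB := BilateralGammaOU.charFun_bilateralGamma_mul_exp hk hlam' hβ₁ hβ₂ hp₀ hp₁
    have hB₀ : ∀ v, charFun (BilateralGammaOU.bilateralGamma (p * lam / k) β₁ ((1 - p) * lam / k) β₂)
        v = Complex.exp (BilateralGammaOU.cumulantLimit k lam p β₁ β₂ - G v 0) := fun v => by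
      simpa using hB v 0
    have hlim : ∀ v, Tendsto (fun t => charFun (μ.map (X t)) v) atTop
        (𝓝 (charFun (BilateralGammaOU.bilateralGamma (p * lam / k) β₁ ((1 - p) * lam / k) β₂) v)) :=
        fun v => by
      have h1 := (continuous_charFun (μ := μ.map X₀)).tendsto 0 |>.comp
        (BilateralGammaOU.tendsto_exp_neg_mul_nnreal hk v)
      have h2 := (Complex.continuous_exp.tendsto _).comp
        ((BilateralGammaOU.tendsto_cumulantPrimitive (lam := lam) (p := p) hk hβ₁ hβ₂ v).sub_const
          (G v 0))
      have h := h1.mul h2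
      rw [charFun_zero, probReal_univ, Complex.ofReal_one, one_mul, ← hB₀] at h
      exact h.congr fun t => (hchar t v).symm
    refine ⟨⟨fun h => Measure.ext_of_charFun (funext fun v => ?_), fun h t => ?_⟩,
      BilateralGammaOU.tendsto_integral_of_tendsto_charFun hX.measurable hlim⟩
    -- For an invariant law the convergent family is constant, hence equal to its limit.
    · have := hlim v
      simp_rw [h] at this
      exact tendsto_nhds_unique tendsto_const_nhds this
    · have := Measure.isProbabilityMeasure_map (μ := μ) (hX.measurable t).aemeasurable
      refine Measure.ext_of_charFun (funext fun v => ?_)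
      rw [hchar, h, hB, hB₀, ← Complex.exp_add]
      congr 1
      simp only [G]
      ring
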